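/- Let $\mathfrak g$ be a simple complex Lie algebra of type $A_n$ ($n\ge 1$), $D_n$ ($n\ge 4$), $E_6$, $E_7$ or $E_8$, let $I$ be the vertex set of its Dynkin diagram, $C=(C_{ij})$ its Cartan matrix, $\alpha_i$ ($i\in I$) the simple roots, $(\cdot,\cdot)$ the scalar product with $(\alpha_i,\alpha_j)=C_{ij}$, $s_i$ the simple reflections, and $\Delta_+$ the set of positive roots ($\Delta_-=-\Delta_+$). Let $C(z)$ be the $I\times I$ matrix over $\mathbb{Q}(z)$ with $C_{ii}(z)=z+z^{-1}$, $C_{ij}(z)=-1$ if $i,j$ are adjacent, and $C_{ij}(z)=0$ otherwise. Let $\widetilde C(z)=C(z)^{-1}$, and write $\widetilde C_{ij}(z)=\sum_{m\ge 1}\widetilde C_{ij}(m)z^m$ for the expansion at $z=0$; put $\widetilde C_{ij}(m)=0$ for $m\le 0$. For $i,j\in I$ and $p,s\in\mathbb{Z}$ set $$\mathcal N(i,p;j,s)=\widetilde C_{ij}(p-s-1)-\widetilde C_{ij}(p-s+1)-\widetilde C_{ij}(s-p-1)+\widetilde C_{ij}(s-p+1).$$ Let $Q$ be an orientation of the Dynkin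 diagram and $\xi\colon I\to\mathbb{Z}$ a height function, i.e. $\xi_j=\xi_i-1$ for every arrow $i\to j$ of $Q$. Put $\widehat I=\{(i,p)\in I\times\mathbb{Z}\mid p-\xi_i\in 2\mathbb{Z}\}$. Let $\tau=s_{i_1}\cdots s_{i_n}$ be the Coxeter element attached to an ordering $(i_1,\dots,i_n)$ of $I$ adapted to $Q$: $i_1$ is a source of $Q$, and $i_k$ is a source of the quiver obtained from $Q$ by successively reversing all arrows at $i_1$, then at $i_2$, …, then at $i_{k-1}$ (such orderings exist, and $\tau$ does not depend on the choice). Let $\gamma_i=\sum_j\alpha_j$, the sum over all $j$ having a (possibly trivial) oriented path from $j$ to $i$ in $Q$. Let $\varphi\colon\widehat I\to\Delta_+\times\mathbb{Z}$ be the bijection determined by $\varphi(i,\xi_i)=(\gamma_i,0)$ and, if $\varphi(i,p)=(\beta,m)$, by: $\varphi(i,p-2)$ is $(\tau(\beta),m)$ if $\tau(\beta)\in\Delta_+$ and $(-\tau(\beta),m-1)$ if $\tau(\beta)\in\Delta_-$; $\varphi(i,p+2)$ is $(\tau^{-1}(\beta),m)$ if $\tau^{-1}(\beta)\in\Delta_+$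 and $(-\tau^{-1}(\beta),m+1)$ if $\tau^{-1}(\beta)\in\Delta_-$. Then for all $(i,p),(j,s)\in\widehat I$ with $p<s$, $$\mathcal N(i,p;j,s)=\left(\tau^{(s-p+\xi_i-\xi_j)/2}(\gamma_i),\ \gamma_j\right).$$ Moreover, if $\varphi(i,p)=(\beta,m)$ and $\varphi(j,s)=(\delta,l)$, then $$\mathcal N(i,p;j,s)=(-1)^{l-m}(\beta,\delta).$$ -/

import Mathlib

namespace QuantumTorusADE

/-! ### Dynkin diagrams, root lattice, Weyl group -/

section Roots

variable {I : Type*} [Fintype I] [DecidableEq I]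

open Classical in
/-- The simply laced Cartan matrix attached to a graph: `2` on the diagonal, `-1` at adjacent
vertices and `0` otherwise. -/
noncomputable def cartan (G : SimpleGraph I) : Matrix I I ℤ :=
  Matrix.of fun i j => if i = j then 2 else if G.Adj i j then -1 else 0

/-- `G` is a Dynkin diagram of type `A_n` (`n ≥ 1`), `D_n` (`n ≥ 4`), `E_6`, `E_7` or `E_8`:
up to a numbering of its vertices, its Cartan matrix is the one of that type. -/
def IsADE (G : SimpleGraph I) : Prop :=
  (∃ n : ℕ, 1 ≤ n ∧ ∃ e : I ≃ Fin n, cartan G = (CartanMatrix.A n).submatrix e e) ∨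
  (∃ n : ℕ, 4 ≤ n ∧ ∃ e : I ≃ Fin n, cartan G = (CartanMatrix.D n).submatrix e e) ∨
  (∃ e : I ≃ Fin 6, cartan G = CartanMatrix.E₆.submatrix e e) ∨
  (∃ e : I ≃ Fin 7, cartan G = CartanMatrix.E₇.submatrix e e) ∨
  (∃ e : I ≃ Fin 8, cartan G = CartanMatrix.E₈.submatrix e e)

/-- The root lattice `⨁ i, ℤ α_i`; an element is given by its coordinates in the basis of
simple roots. -/
abbrev RootLattice (I : Type*) : Type _ := I → ℤ

/-- The simple root `α_i`. -/
def simpleRoot (i : I) : RootLattice I := Pi.single i 1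

/-- The scalar product of the root lattice: the bilinear form with `(α_i, α_j) = C_{ij}`. -/
noncomputable def form (G : SimpleGraph I) (x y : RootLattice I) : ℤ :=
  ∑ i, ∑ j, x i * cartan G i j * y j

lemma form_simpleRoot (G : SimpleGraph I) (x : RootLattice I) (i : I) :
    form G x (simpleRoot i) = ∑ k, x k * cartan G k i := by
  simp [form, simpleRoot, Pi.single_apply]

/-- The simple reflection `s_i(x) = x - (x, α_i) α_i` as an endomorphism of the root lattice. -/
noncomputable def reflectionHom (G : SimpleGraph I) (i : I) :
    RootLattice I →ₗ[ℤ] RootLattice I where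
  toFun x := x - form G x (simpleRoot i) • simpleRoot i
  map_add' x y := by
    simp only [form_simpleRoot, Pi.add_apply, add_mul, Finset.sum_add_distrib, add_smul]
    abel
  map_smul' c x := by
    simp only [form_simpleRoot, Pi.smul_apply, smul_eq_mul, mul_assoc, ← Finset.mul_sum,
      mul_smul, RingHom.id_apply, smul_sub]

lemma reflectionHom_involutive (G : SimpleGraph I) (i : I) :
    Function.Involutive (reflectionHom G i) := by
  intro x
  have h : form G (simpleRoot i) (simpleRoot i) = 2 := by
    rw [form_simpleRoot, Finset.sum_eq_single i] <;>
      simp +contextual [simpleRoot, Pi.single_apply, cartan]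
  have h2 : form G (reflectionHom G i x) (simpleRoot i) = - form G x (simpleRoot i) := by
    have : form G (reflectionHom G i x) (simpleRoot i)
        = form G x (simpleRoot i)
          - form G x (simpleRoot i) * form G (simpleRoot i) (simpleRoot i) := by
      rw [form_simpleRoot G (reflectionHom G i x), form_simpleRoot G (simpleRoot i),
        Finset.mul_sum]
      conv_rhs => enter [1]; rw [form_simpleRoot]
      rw [← Finset.sum_sub_distrib]
      refine Finset.sum_congr rfl fun k _ => ?_
      simp only [reflectionHom, LinearMap.coe_mk, AddHom.coe_mk, Pi.sub_apply, Pi.smul_apply,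
        smul_eq_mul]
      ring
    rw [this, h]; ring
  change reflectionHom G i x - form G (reflectionHom G i x) (simpleRoot i) • simpleRoot i = x
  rw [h2]
  simp [reflectionHom]

/-- The simple reflection `s_i` as an automorphism of the root lattice. -/
noncomputable def simpleReflection (G : SimpleGraph I) (i : I) :
    RootLattice I ≃ₗ[ℤ] RootLattice I :=
  LinearEquiv.ofInvolutive (reflectionHom G i) (reflectionHom_involutive G i)

/-- The Weyl group, acting on the root lattice. -/
noncomputable def weylGroup (G : SimpleGraph I) :
    Subgroup (RootLattice I ≃ₗ[ℤ] RootLattice I) :=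
  Subgroup.closure (Set.range (simpleReflection G))

/-- The root system `Δ = W Π`. -/
def roots (G : SimpleGraph I) : Set (RootLattice I) :=
  {β | ∃ w ∈ weylGroup G, ∃ i : I, β = w (simpleRoot i)}

/-- The positive roots `Δ_+ = Δ ∩ ⨁ i, ℕ α_i`. -/
def posRoots (G : SimpleGraph I) : Set (RootLattice I) :=
  {β | β ∈ roots G ∧ ∀ i, 0 ≤ β i}

end Roots

/-! ### Quivers, the adapted Coxeter element, the labelling of the repetition quiver -/

section Quivers

variable {I : Type*}

/-- The relation `Q` (with `Q i j` meaning that there is an arrow `i → j`) is an orientation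
of the graph `G`. -/
structure IsOrientation (G : SimpleGraph I) (Q : I → I → Prop) : Prop where
  adj_iff : ∀ i j, G.Adj i j ↔ Q i j ∨ Q j i
  asymm : ∀ i j, Q i j → ¬ Q j i

/-- A height function: `ξ_j = ξ_i - 1` for every arrow `i → j`. -/
def IsHeight (Q : I → I → Prop) (ξ : I → ℤ) : Prop :=
  ∀ i j, Q i j → ξ j = ξ i - 1

/-- `i` is a source of `Q`. -/
def IsSource (Q : I → I → Prop) (i : I) : Prop := ∀ j, ¬ Q j i

/-- The quiver `s_i(Q)`: all arrows with source or target `i` are reversed. -/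
def reverseAt (Q : I → I → Prop) (i : I) : I → I → Prop :=
  fun a b => ((a = i ∨ b = i) ∧ Q b a) ∨ (¬ (a = i ∨ b = i) ∧ Q a b)

/-- `(i_1, …, i_k)` is adapted to `Q`: `i_1` is a source of `Q`, `i_2` is a source of
`s_{i_1}(Q)`, and so on. -/
def IsAdapted : (I → I → Prop) → List I → Prop
  | _, [] => True
  | Q, i :: l => IsSource Q i ∧ IsAdapted (reverseAt Q i) l

lemma isAdapted_of_pairwise (l : List I) : ∀ Q : I → I → Prop, (∀ a, ¬ Q a a) →
    l.Nodup → l.Pairwise (fun a b => ¬ Q b a) → (∀ a ∈ l, ∀ b, b ∉ l → ¬ Q b a) →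
    IsAdapted Q l := by
  induction l with
  | nil => intros; trivial
  | cons i l ih =>
    intro Q hirr hnd hp hout
    rw [List.nodup_cons] at hnd
    rw [List.pairwise_cons] at hp
    refine ⟨fun j hj => ?_, ih _ ?_ hnd.2 ?_ ?_⟩
    · by_cases hji : j = i
      · exact hirr i (hji ▸ hj)
      · by_cases hjl : j ∈ l
        · exact hp.1 j hjl hj
        · exact hout i (by simp) j (by simp [hji, hjl]) hj
    · rintro a (h | h)
      · exact hirr a h.2
      · exact hirr a h.2
    · refine hp.2.imp_of_mem ?_
      rintro a b ha hb hab (⟨h | h, -⟩ | ⟨-, h⟩)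
      · exact hnd.1 (h ▸ hb)
      · exact hnd.1 (h ▸ ha)
      · exact hab h
    · rintro a ha b hb (⟨h | h, h'⟩ | ⟨h, h'⟩)
      · subst h; exact hp.1 a ha h'
      · exact hnd.1 (h ▸ ha)
      · exact hout a (by simp [ha]) b (by simp only [List.mem_cons]; tauto) h'

variable [Fintype I] [DecidableEq I]

/-- `τ` is the Coxeter element having a reduced expression adapted to `Q`: we have
`τ = s_{i_1} ⋯ s_{i_n}` for an ordering `(i_1, …, i_n)` of the vertices adapted to `Q`. -/
def IsAdaptedCoxeter (G : SimpleGraph I) (Q : I → I → Prop)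
    (τ : RootLattice I ≃ₗ[ℤ] RootLattice I) : Prop :=
  ∃ l : List I, l.Nodup ∧ (∀ i, i ∈ l) ∧ IsAdapted Q l ∧ τ = (l.map (simpleReflection G)).prod

/-- Adapted Coxeter elements exist. -/
theorem exists_isAdaptedCoxeter (G : SimpleGraph I) (Q : I → I → Prop) (ξ : I → ℤ)
    (hξ : IsHeight Q ξ) : ∃ τ, IsAdaptedCoxeter G Q τ := by
  set l := (Finset.univ : Finset I).toList.mergeSort (fun a b => decide (ξ b ≤ ξ a)) with hl
  have hperm := List.mergeSort_perm (Finset.univ : Finset I).toList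
    (fun a b => decide (ξ b ≤ ξ a))
  have hmem : ∀ i, i ∈ l := fun i => hperm.mem_iff.2 (by simp)
  have hnd : l.Nodup := hperm.nodup_iff.2 (Finset.nodup_toList _)
  refine ⟨_, l, hnd, hmem, isAdapted_of_pairwise l Q ?_ hnd ?_ ?_, rfl⟩
  · intro a h; have := hξ a a h; omega
  · have hs : l.Pairwise (fun a b => decide (ξ b ≤ ξ a) = true) :=
      List.pairwise_mergeSort (by intro a b c; simp; omega) (by intro a b; simp; omega) _
    refine hs.imp ?_
    intro a b hab h
    have := hξ b a h
    simp at hab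
    omega
  · intro a _ b hb; exact absurd (hmem b) hb

/-- `Î = {(i, p) | p - ξ_i is even}`, the vertex set of the repetition quiver. -/
def repetitionVertices (ξ : I → ℤ) : Set (I × ℤ) := {v | Even (v.2 - ξ v.1)}

open Classical in
/-- `γ_i` is the sum of the `α_j` over all `j` with a (possibly trivial) path from `j` to `i`. -/
noncomputable def gammaRoot (Q : I → I → Prop) (i : I) : RootLattice I :=
  ∑ j ∈ Finset.univ.filter (fun j => Relation.ReflTransGen Q j i), simpleRoot j

open Classical in
/-- The passage from `φ(i, p)` to `φ(i, p - 2)`. For a root `β` the second case means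
`τ(β) ∈ Δ_-`. -/
noncomputable def labelDown (G : SimpleGraph I) (τ : RootLattice I ≃ₗ[ℤ] RootLattice I) :
    RootLattice I × ℤ → RootLattice I × ℤ :=
  fun x => if τ x.1 ∈ posRoots G then (τ x.1, x.2) else (-τ x.1, x.2 - 1)

open Classical in
/-- The passage from `φ(i, p)` to `φ(i, p + 2)`. For a root `β` the second case means
`τ⁻¹(β) ∈ Δ_-`. -/
noncomputable def labelUp (G : SimpleGraph I) (τ : RootLattice I ≃ₗ[ℤ] RootLattice I) :
    RootLattice I × ℤ → RootLattice I × ℤ :=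
  fun x => if τ⁻¹ x.1 ∈ posRoots G then (τ⁻¹ x.1, x.2) else (-τ⁻¹ x.1, x.2 + 1)

/-- The labelling `φ` of the vertices of the repetition quiver by `Δ_+ × ℤ`: it starts from
`φ(i, ξ_i) = (γ_i, 0)`, and `φ(i, ξ_i + 2k)` is obtained by `k` steps up if `k ≥ 0` and by `-k`
steps down if `k < 0`. -/
noncomputable def labelling (G : SimpleGraph I) (Q : I → I → Prop)
    (τ : RootLattice I ≃ₗ[ℤ] RootLattice I) (ξ : I → ℤ) (v : repetitionVertices ξ) :
    RootLattice I × ℤ :=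
  let k : ℤ := (v.1.2 - ξ v.1.1) / 2
  if 0 ≤ k then (labelUp G τ)^[k.toNat] (gammaRoot Q v.1.1, 0)
  else (labelDown G τ)^[(-k).toNat] (gammaRoot Q v.1.1, 0)

end Quivers

/-! ### The quantum Cartan matrix and the `t`-commutation exponent -/

section QuantumCartan

variable {I : Type*} [Fintype I] [DecidableEq I]

open Classical in
/-- The quantum Cartan matrix `C(z)`: `z + z⁻¹` on the diagonal, `-1` at adjacent vertices and
`0` otherwise. -/
noncomputable def quantumCartan (G : SimpleGraph I) : Matrix I I (RatFunc ℚ) :=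
  Matrix.of fun i j =>
    if i = j then RatFunc.X + RatFunc.X⁻¹ else if G.Adj i j then -1 else 0

/-- `C̃_{ij}(m)`: for `m ≥ 1` the coefficient of `z^m` in the expansion at `z = 0` of the
`(i, j)` entry of the inverse `C̃(z)` of `C(z)`, and `0` for `m ≤ 0`. -/
noncomputable def cTilde (G : SimpleGraph I) (i j : I) (m : ℤ) : ℚ :=
  if 1 ≤ m then ((((quantumCartan G)⁻¹ i j : RatFunc ℚ) : LaurentSeries ℚ)).coeff m else 0

/-- The `t`-commutation exponent `N(i, p; j, s)`. -/
noncomputable def commExponent (G : SimpleGraph I) (i : I) (p : ℤ) (j : I) (s : ℤ) : ℚ :=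
  cTilde G i j (p - s - 1) - cTilde G i j (p - s + 1)
    - cTilde G i j (s - p - 1) + cTilde G i j (s - p + 1)

end QuantumCartan

end QuantumTorusADE

namespace QuantumTorusADE

/-! ### Dynkin diagrams of finite simply laced type are forests -/

/-! The diagram is a forest, so the operator E with (E x)_i = x_i - ∑_{k → i} x_k is inverted by
counting oriented paths, and its analogue E' for the reversed arrows is its transpose. The scalar
product satisfies (x, α_i) = (E x)_i + (E' x)_i, and the adapted Coxeter element is characterised by
E' τ = -E (`IsAdaptedCoxeter.eulerCoord_flip_apply`). Two facts follow: (τ y, γ_j) = (τ y)_j - y_j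
(`IsAdaptedCoxeter.form_apply_gammaRoot`), and the vectors f(i, p) = τ^{(ξ_i - p)/2}(γ_i) satisfy
the mesh relation f(i, p) + f(i, p - 2) = ∑_{k ~ i} f(k, p - 1) (`IsAdaptedCoxeter.meshRoot_add`).

At α_j the coordinate of f(i, p) is 0 for p = ξ_j + 1 and δ_ij for p = ξ_j. With these initial
values the mesh relation says that ∑_m f(i, ξ_j + 1 - m)_j z^m is the (i, j) entry of the inverse of
C(z), so each coefficient of the inverse is a coordinate of some f (`cTilde_eq_meshRoot`). For p < s
only two terms of the exponent survive. They are the α_j-coordinates of τ y and y for one vector y,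
so their difference is a scalar product with γ_j. The second formula follows from the τ-invariance
of the form, since the label at (i, p) is (-1)^m f(i, p). -/

lemma isAcyclic_of_unique_smaller_neighbor {V : Type*} (G : SimpleGraph V) (f : V → ℤ)
    (hf : Function.Injective f)
    (h : ∀ v a b, G.Adj v a → G.Adj v b → f a < f v → f b < f v → a = b) :
    G.IsAcyclic := by
  classical
  intro v c hc
  -- At a vertex of the cycle where `f` is maximal, both neighbours along the cycle are smaller,
  -- hence equal; a cycle does not allow this.
  obtain ⟨u, hu, hmax⟩ := c.support.toFinset.exists_max_image f ⟨v, by simp⟩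
  rw [List.mem_toFinset] at hu
  have hlt : ∀ x ∈ (c.rotate u hu).support, G.Adj u x → f x < f u := by
    intro x hx hux
    refine lt_of_le_of_ne (hmax x ?_) fun he => hux.ne (hf he).symm
    rw [List.mem_toFinset]
    exact (SimpleGraph.Walk.mem_support_rotate_iff ..).1 hx
  have hr := hc.rotate hu
  have h1 := (c.rotate u hu).adj_snd hr.not_nil
  have h2 := ((c.rotate u hu).adj_penultimate hr.not_nil).symm
  exact hr.snd_ne_penultimate (h u _ _ h1 h2
    (hlt _ (SimpleGraph.Walk.getVert_mem_support _ _) h1)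
    (hlt _ (SimpleGraph.Walk.getVert_mem_support _ _) h2))

section Roots

variable {I : Type*} [Fintype I] [DecidableEq I]

lemma cartan_eq_of_adj {G : SimpleGraph I} {a b : I} (h : G.Adj a b) : cartan G a b = -1 := by
  simp [cartan, h.ne, h]

lemma isAcyclic_of_cartan_eq_submatrix {G : SimpleGraph I} {n : ℕ}
    {M : Matrix (Fin n) (Fin n) ℤ} (e : I ≃ Fin n) (hM : cartan G = M.submatrix e e)
    (f : Fin n → ℤ) (hf : Function.Injective f)
    (h : ∀ v a b, decide (M v a = -1) = true → decide (M v b = -1) = true →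
      f a < f v → f b < f v → a = b) :
    G.IsAcyclic := by
  have hadj : ∀ a b, G.Adj a b → decide (M (e a) (e b) = -1) = true := fun a b hab => by
    rw [decide_eq_true_iff, ← cartan_eq_of_adj hab, hM]; rfl
  exact isAcyclic_of_unique_smaller_neighbor G (f ∘ e) (hf.comp e.injective)
    fun v a b ha hb hav hbv => e.injective (h _ _ _ (hadj _ _ ha) (hadj _ _ hb) hav hbv)

lemma IsADE.isAcyclic {G : SimpleGraph I} (hG : IsADE G) : G.IsAcyclic := by
  have hpos : ∀ n : ℕ, Function.Injective fun a : Fin n => (a.val : ℤ) :=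
    fun n a b h => Fin.ext (by simpa using h)
  have hneg : ∀ n : ℕ, Function.Injective fun a : Fin n => -(a.val : ℤ) :=
    fun n a b h => Fin.ext (by simpa using h)
  rcases hG with ⟨n, -, e, he⟩ | ⟨n, -, e, he⟩ | ⟨e, he⟩ | ⟨e, he⟩ | ⟨e, he⟩
  · refine isAcyclic_of_cartan_eq_submatrix e he _ (hpos n) fun v a b ha hb hav hbv => ?_
    rw [decide_eq_true_iff] at ha hb
    simp only [CartanMatrix.A, Matrix.of_apply] at ha hb
    split_ifs at ha hb <;> omega
  · refine isAcyclic_of_cartan_eq_submatrix e he _ (hpos n) fun v a b ha hb hav hbv => ?_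
    rw [decide_eq_true_iff] at ha hb
    simp only [CartanMatrix.D, Matrix.of_apply] at ha hb
    split_ifs at ha hb <;> omega
  -- For the types E the order of the indices is reversed: each vertex has at most one neighbour of
  -- larger index.
  all_goals
    refine isAcyclic_of_cartan_eq_submatrix e he _ (hneg _) ?_
    decide

end Roots

/-! ### Path counting in an oriented forest -/

section Paths

variable {I : Type*} {G : SimpleGraph I} {Q : I → I → Prop} {ξ : I → ℤ}

lemma IsOrientation.flip (hQ : IsOrientation G Q) : IsOrientation G (flip Q) :=
  ⟨fun i j => (hQ.adj_iff i j).trans or_comm, fun i j h => hQ.asymm j i h⟩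

lemma IsHeight.flip (hξ : IsHeight Q ξ) : IsHeight (flip Q) (-ξ) := fun i j h => by
  have := hξ j i h
  simp only [Pi.neg_apply]
  omega

lemma IsHeight.eq_or_lt (hξ : IsHeight Q ξ) {j i : I} (h : Relation.ReflTransGen Q j i) :
    j = i ∨ ξ i < ξ j := by
  induction h with
  | refl => exact Or.inl rfl
  | tail _ hb ih =>
    have := hξ _ _ hb
    rcases ih with rfl | h <;> right <;> omega

/-- Heights drop along arrows, so an oriented walk never revisits a vertex. The height bound is the
induction invariant that keeps the new endpoint off the walk. -/
lemma exists_isPath_of_reflTransGen (hQ : IsOrientation G Q) (hξ : IsHeight Q ξ) {j i : I}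
    (h : Relation.ReflTransGen Q j i) :
    ∃ w : G.Walk j i, w.IsPath ∧ ∀ v ∈ w.support, ξ i ≤ ξ v := by
  induction h with
  | refl => exact ⟨.nil, by simp, by simp⟩
  | @tail b c _ hbc ih =>
    obtain ⟨w, hw, hle⟩ := ih
    have hlt := hξ _ _ hbc
    have hadj : G.Adj b c := (hQ.adj_iff _ _).2 (Or.inl hbc)
    refine ⟨w.concat hadj, hw.concat (fun hc => ?_) hadj, fun v hv => ?_⟩
    · have := hle _ hc
      omega
    · rw [SimpleGraph.Walk.support_concat, List.mem_append, List.mem_singleton] at hv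
      rcases hv with hv | rfl
      · have := hle _ hv
        omega
      · exact le_rfl

/-- Paths in a forest are unique, so the two resulting paths from `j` to `i` have the same
penultimate vertex. -/
lemma eq_of_reflTransGen_of_arrow (hG : G.IsAcyclic) (hQ : IsOrientation G Q)
    (hξ : IsHeight Q ξ) {j k k' i : I} (hk : Relation.ReflTransGen Q j k)
    (hk' : Relation.ReflTransGen Q j k') (hi : Q k i) (hi' : Q k' i) : k = k' := by
  obtain ⟨w, hw, hle⟩ := exists_isPath_of_reflTransGen hQ hξ hk
  obtain ⟨w', hw', hle'⟩ := exists_isPath_of_reflTransGen hQ hξ hk'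
  have h1 := hξ _ _ hi
  have h2 := hξ _ _ hi'
  have a1 : G.Adj k i := (hQ.adj_iff _ _).2 (Or.inl hi)
  have a2 : G.Adj k' i := (hQ.adj_iff _ _).2 (Or.inl hi')
  have p1 : (w.concat a1).IsPath := hw.concat (fun hc => by have := hle _ hc; omega) a1
  have p2 : (w'.concat a2).IsPath := hw'.concat (fun hc => by have := hle' _ hc; omega) a2
  have := congrArg Subtype.val ((hG.subsingleton_path j i).elim ⟨_, p1⟩ ⟨_, p2⟩)
  simpa using congrArg SimpleGraph.Walk.penultimate this

open Classical in
/-- `1` if there is an oriented path from `j` to `i`, and `0` otherwise. -/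
noncomputable def reach (Q : I → I → Prop) (j i : I) : ℤ :=
  if Relation.ReflTransGen Q j i then 1 else 0

lemma reach_self (Q : I → I → Prop) (i : I) : reach Q i i = 1 := if_pos .refl

lemma reach_flip (Q : I → I → Prop) (j i : I) : reach (flip Q) j i = reach Q i j := by
  unfold reach
  congr 1
  exact propext Relation.reflTransGen_swap

lemma reach_eq_zero (hξ : IsHeight Q ξ) {j i : I} (hne : j ≠ i) (h : ξ j ≤ ξ i) :
    reach Q j i = 0 := by
  refine if_neg fun hr => ?_
  rcases hξ.eq_or_lt hr with h' | h'
  · exact hne h'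
  · omega

variable [Fintype I]

open Classical in
/-- Subtracting from each coordinate of `x` the coordinates at the tails of the arrows
arriving there. -/
noncomputable def eulerCoord (Q : I → I → Prop) (x : I → ℤ) (i : I) : ℤ :=
  x i - ∑ k, if Q k i then x k else 0

lemma eulerCoord_add (Q : I → I → Prop) (x y : I → ℤ) (i : I) :
    eulerCoord Q (x + y) i = eulerCoord Q x i + eulerCoord Q y i := by
  simp only [eulerCoord, Pi.add_apply, ← Finset.sum_filter, Finset.sum_add_distrib]
  ring

lemma eulerCoord_sub (Q : I → I → Prop) (x y : I → ℤ) (i : I) :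
    eulerCoord Q (x - y) i = eulerCoord Q x i - eulerCoord Q y i := by
  rw [eq_sub_iff_add_eq, ← eulerCoord_add, sub_add_cancel]

variable [DecidableEq I]

/-- A nontrivial oriented path to `i` passes through exactly one last arrow `k → i`, so the
contributions cancel unless `j = i`. -/
lemma eulerCoord_reach (hG : G.IsAcyclic) (hQ : IsOrientation G Q) (hξ : IsHeight Q ξ)
    (j i : I) : eulerCoord Q (reach Q j) i = if j = i then 1 else 0 := by
  classical
  unfold eulerCoord
  by_cases hji : j = i
  · subst hji
    rw [if_pos rfl, reach_self, Finset.sum_eq_zero, sub_zero]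
    intro k _
    split_ifs with hk
    · have := hξ _ _ hk
      refine reach_eq_zero hξ ?_ (by omega)
      rintro rfl
      omega
    · rfl
  · rw [if_neg hji, sub_eq_zero]
    by_cases h : Relation.ReflTransGen Q j i
    · obtain h' | ⟨k, hk, hki⟩ := Relation.ReflTransGen.cases_tail_iff Q j i |>.1 h
      · exact absurd h'.symm hji
      · rw [Finset.sum_eq_single k, if_pos hki, reach, reach, if_pos h, if_pos hk]
        · intro k' _ hne
          split_ifs with hk'
          · exact if_neg fun hr => hne (eq_of_reflTransGen_of_arrow hG hQ hξ hr hk hk' hki)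
          · rfl
        · simp
    · rw [reach, if_neg h, Finset.sum_eq_zero]
      intro k _
      split_ifs with hk
      · exact if_neg fun hr => h (hr.tail hk)
      · rfl

lemma eulerCoord_flip_reach (hG : G.IsAcyclic) (hQ : IsOrientation G Q) (hξ : IsHeight Q ξ)
    (j i : I) : eulerCoord (flip Q) (fun k => reach Q k j) i = if j = i then 1 else 0 := by
  rw [← eulerCoord_reach hG hQ.flip hξ.flip]
  simp only [← reach_flip Q]

/-- Reversing the arrows transposes the operator, so this is the inversion formula for `flip Q`
paired with `z`. It also yields injectivity of `eulerCoord Q`. -/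
lemma sum_eulerCoord_mul_reach (hG : G.IsAcyclic) (hQ : IsOrientation G Q)
    (hξ : IsHeight Q ξ) (z : I → ℤ) (j : I) :
    ∑ i, eulerCoord Q z i * reach Q i j = z j := by
  classical
  have h : ∀ k, z k * eulerCoord (flip Q) (fun i => reach Q i j) k
      = z k * if j = k then 1 else 0 := fun k => by rw [eulerCoord_flip_reach hG hQ hξ]
  have h' := Finset.sum_congr rfl fun k (_ : k ∈ Finset.univ) => h k
  simp only [mul_ite, mul_one, mul_zero, Finset.sum_ite_eq, Finset.mem_univ, if_true] at h'
  rw [← h']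
  simp only [eulerCoord, sub_mul, mul_sub, Finset.sum_sub_distrib, Finset.sum_mul,
    Finset.mul_sum]
  congr 1
  rw [Finset.sum_comm]
  exact Finset.sum_congr rfl fun k _ => Finset.sum_congr rfl fun i _ => by
    by_cases h : Q k i <;> simp [h, flip]

lemma eq_zero_of_eulerCoord_eq_zero (hG : G.IsAcyclic) (hQ : IsOrientation G Q)
    (hξ : IsHeight Q ξ) {z : I → ℤ} (h : ∀ i, eulerCoord Q z i = 0) : z = 0 := by
  funext j
  rw [← sum_eulerCoord_mul_reach hG hQ hξ z j]
  simp [h]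

end Paths


section Coxeter

variable {I : Type*} [Fintype I] [DecidableEq I] {G : SimpleGraph I} {Q : I → I → Prop}
  {ξ : I → ℤ}

/-! ### The scalar product -/

lemma form_eq_toBilin' (G : SimpleGraph I) (x y : RootLattice I) :
    form G x y = Matrix.toBilin' (cartan G) x y := by
  rw [Matrix.toBilin'_apply, form]

lemma cartan_comm (G : SimpleGraph I) (i j : I) : cartan G i j = cartan G j i := by
  have h : G.Adj i j ↔ G.Adj j i := G.adj_comm i j
  by_cases hij : i = j
  · rw [hij]
  · by_cases h' : G.Adj i j
    · simp [cartan, hij, Ne.symm hij, h', h.1 h']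
    · simp [cartan, hij, Ne.symm hij, h', mt h.2 h']

lemma form_comm (G : SimpleGraph I) (x y : RootLattice I) : form G x y = form G y x := by
  unfold form
  rw [Finset.sum_comm]
  refine Finset.sum_congr rfl fun i _ => Finset.sum_congr rfl fun j _ => ?_
  rw [cartan_comm G j i]
  ring

lemma form_simpleRoot_self (G : SimpleGraph I) (i : I) :
    form G (simpleRoot i) (simpleRoot i) = 2 := by
  rw [form_simpleRoot, Finset.sum_eq_single i] <;> simp +contextual [simpleRoot, cartan]

lemma form_zsmul_zsmul (G : SimpleGraph I) (a b : ℤ) (x y : RootLattice I) :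
    form G (a • x) (b • y) = a * b * form G x y := by
  simp only [form_eq_toBilin', map_smul, LinearMap.smul_apply, smul_eq_mul]
  ring

lemma simpleReflection_apply (G : SimpleGraph I) (i : I) (x : RootLattice I) :
    simpleReflection G i x = x - form G x (simpleRoot i) • simpleRoot i := rfl

lemma form_simpleReflection (G : SimpleGraph I) (i : I) (x y : RootLattice I) :
    form G (simpleReflection G i x) (simpleReflection G i y) = form G x y := by
  have h1 := form_comm G y (simpleRoot i)
  have h2 := form_simpleRoot_self G i
  simp only [simpleReflection_apply, form_eq_toBilin', map_sub, map_smul, LinearMap.sub_apply,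
    LinearMap.smul_apply, smul_eq_mul] at h1 h2 ⊢
  rw [h2, h1]
  ring

lemma IsAdaptedCoxeter.form_apply {τ : RootLattice I ≃ₗ[ℤ] RootLattice I}
    (hτ : IsAdaptedCoxeter G Q τ) (x y : RootLattice I) : form G (τ x) (τ y) = form G x y := by
  obtain ⟨l, -, -, -, rfl⟩ := hτ
  induction l with
  | nil => rfl
  | cons a l ih =>
    rw [List.map_cons, List.prod_cons]
    exact (form_simpleReflection G a _ _).trans ih

lemma IsAdaptedCoxeter.form_zpow_apply {τ : RootLattice I ≃ₗ[ℤ] RootLattice I}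
    (hτ : IsAdaptedCoxeter G Q τ) (k : ℤ) (x y : RootLattice I) :
    form G ((τ ^ k) x) ((τ ^ k) y) = form G x y := by
  induction k with
  | zero => rfl
  | succ n ih =>
    rw [add_comm, zpow_add, zpow_one]
    exact (hτ.form_apply _ _).trans ih
  | pred n ih =>
    rw [← hτ.form_apply, ← ih]
    have h : ∀ z, τ ((τ ^ (-(n : ℤ) - 1)) z) = (τ ^ (-(n : ℤ))) z := fun z => by
      change (τ * τ ^ (-(n : ℤ) - 1)) z = _
      rw [← zpow_one_add, add_sub_cancel]
    rw [h, h]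

open Classical in
lemma IsOrientation.cartan_eq (hQ : IsOrientation G Q) (hξ : IsHeight Q ξ) (k i : I) :
    cartan G k i = (if k = i then 2 else 0) - (if Q k i then 1 else 0)
      - (if Q i k then 1 else 0) := by
  have hirr : ¬ Q k k := fun h => by have := hξ _ _ h; omega
  by_cases hki : k = i
  · subst hki
    simp [cartan, hirr]
  · have h1 := hQ.adj_iff k i
    have h2 := hQ.asymm k i
    by_cases hk : Q k i <;> by_cases hi : Q i k <;> simp_all [cartan]

open Classical in
lemma eulerCoord_flip (Q : I → I → Prop) (x : I → ℤ) (i : I) :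
    eulerCoord (flip Q) x i = x i - ∑ k, if Q i k then x k else 0 := rfl

lemma form_simpleRoot_eq_eulerCoord (hQ : IsOrientation G Q) (hξ : IsHeight Q ξ)
    (x : RootLattice I) (i : I) :
    form G x (simpleRoot i) = eulerCoord Q x i + eulerCoord (flip Q) x i := by
  classical
  rw [eulerCoord_flip, eulerCoord]
  simp only [form_simpleRoot, hQ.cartan_eq hξ, mul_sub, Finset.sum_sub_distrib, mul_ite, mul_one,
    mul_zero, Finset.sum_ite_eq', Finset.mem_univ, if_true]
  ring

lemma form_eq_sum_form_simpleRoot_mul (G : SimpleGraph I) (x y : RootLattice I) :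
    form G x y = ∑ i, form G x (simpleRoot i) * y i := by
  simp only [form_simpleRoot, Finset.sum_mul]
  rw [form, Finset.sum_comm]

/-! ### Coordinates of the image under the Coxeter element -/

lemma IsAdapted.pairwise {l : List I} : ∀ {Q : I → I → Prop}, l.Nodup → IsAdapted Q l →
    l.Pairwise (fun a b => ¬ Q b a) := by
  induction l with
  | nil => intros; exact List.Pairwise.nil
  | cons i l ih =>
    intro Q hnd had
    rw [List.nodup_cons] at hnd
    refine List.pairwise_cons.2 ⟨fun b _ => had.1 b, (ih hnd.2 had.2).imp_of_mem ?_⟩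
    intro a b ha hb hab hba
    refine hab (Or.inr ⟨?_, hba⟩)
    rintro (rfl | rfl)
    · exact hnd.1 hb
    · exact hnd.1 ha

lemma simpleReflection_apply_of_ne (G : SimpleGraph I) {i k : I} (h : k ≠ i)
    (x : RootLattice I) : simpleReflection G i x k = x k := by
  simp [simpleReflection_apply, simpleRoot, h]

lemma simpleReflection_apply_self (G : SimpleGraph I) (i : I) (x : RootLattice I) :
    simpleReflection G i x i = x i - form G x (simpleRoot i) := by
  simp [simpleReflection_apply, simpleRoot]

/-- Induction over the final segments of the adapted word. When `s_a` acts, the tails of arrows into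
`a` are still untouched, and subtracting `(y, α_a)` turns the reversed coordinate at `a` into minus
the direct one. No arrow runs from the later letters to `a`, so their coordinates are unaffected. -/
lemma prod_simpleReflection_apply (hQ : IsOrientation G Q) (hξ : IsHeight Q ξ)
    (x : RootLattice I) (l : List I) (hnd : l.Nodup) (hp : l.Pairwise (fun a b => ¬ Q b a))
    (hcl : ∀ a ∈ l, ∀ k, Q a k → k ∈ l) :
    (∀ i ∉ l, (l.map (simpleReflection G)).prod x i = x i) ∧
    ∀ i ∈ l, eulerCoord (flip Q) ((l.map (simpleReflection G)).prod x) i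
      = -eulerCoord Q x i := by
  classical
  induction l with
  | nil => exact ⟨fun _ _ => rfl, fun i hi => absurd hi (by simp)⟩
  | cons a l ih =>
    rw [List.nodup_cons] at hnd
    rw [List.pairwise_cons] at hp
    obtain ⟨hout, hin⟩ := ih hnd.2 hp.2 fun b hb k hbk => by
      rcases List.mem_cons.1 (hcl b (List.mem_cons_of_mem _ hb) k hbk) with rfl | h
      · exact absurd hbk (hp.1 b hb)
      · exact h
    rw [List.map_cons, List.prod_cons]
    set y := (l.map (simpleReflection G)).prod x with hy
    have hmul : (simpleReflection G a * (l.map (simpleReflection G)).prod) x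
        = simpleReflection G a y := rfl
    rw [hmul]
    have hirr : ¬ Q a a := fun h => by have := hξ _ _ h; omega
    refine ⟨fun i hi => ?_, fun i hi => ?_⟩
    · rw [List.mem_cons, not_or] at hi
      rw [simpleReflection_apply_of_ne G hi.1, hout i hi.2]
    · have hsum : ∀ i, ¬ Q i a → (∑ k, if flip Q k i then simpleReflection G a y k else 0)
          = ∑ k, if flip Q k i then y k else 0 := fun i hia => by
        refine Finset.sum_congr rfl fun k _ => ?_
        split_ifs with hk
        · refine simpleReflection_apply_of_ne G ?_ y
          rintro rfl
          exact hia hk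
        · rfl
      rcases List.mem_cons.1 hi with rfl | hil
      · have hxy : (∑ k, if Q k i then y k else 0) = ∑ k, if Q k i then x k else 0 := by
          refine Finset.sum_congr rfl fun k _ => ?_
          split_ifs with hk
          · exact hout k fun hkl => hp.1 k hkl hk
          · rfl
        have hfr := form_simpleRoot_eq_eulerCoord hQ hξ y i
        have hi' := hout i hnd.1
        simp only [eulerCoord] at hfr ⊢
        rw [hsum i hirr, simpleReflection_apply_self, hfr, hxy, hi']
        ring
      · rw [← hin i hil, eulerCoord, eulerCoord, hsum i (hp.1 i hil),
          simpleReflection_apply_of_ne]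
        rintro rfl
        exact hnd.1 hil

/-! ### The Coxeter element and the roots γ_i -/

variable {τ : RootLattice I ≃ₗ[ℤ] RootLattice I}

lemma IsAdaptedCoxeter.eulerCoord_flip_apply (hQ : IsOrientation G Q) (hξ : IsHeight Q ξ)
    (hτ : IsAdaptedCoxeter G Q τ) (x : RootLattice I) (i : I) :
    eulerCoord (flip Q) (τ x) i = -eulerCoord Q x i := by
  obtain ⟨l, hnd, hmem, had, rfl⟩ := hτ
  exact (prod_simpleReflection_apply hQ hξ x l hnd (had.pairwise hnd)
    fun _ _ k _ => hmem k).2 i (hmem i)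

lemma gammaRoot_apply (Q : I → I → Prop) (i j : I) : gammaRoot Q i j = reach Q j i := by
  classical
  simp [gammaRoot, reach, simpleRoot, Finset.sum_apply, Pi.single_apply]

/-- The inverse Coxeter element sends `γ_i` to minus the sum of the `α_k` over all `k` with a
path from `i` to `k`. -/
lemma IsAdaptedCoxeter.apply_gammaRoot_flip (hG : G.IsAcyclic) (hQ : IsOrientation G Q)
    (hξ : IsHeight Q ξ) (hτ : IsAdaptedCoxeter G Q τ) (i : I) :
    τ (gammaRoot (flip Q) i) = -gammaRoot Q i := by
  rw [← add_eq_zero_iff_eq_neg]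
  refine eq_zero_of_eulerCoord_eq_zero hG hQ.flip hξ.flip fun k => ?_
  have h1 : gammaRoot (flip Q) i = reach Q i := by
    funext j
    rw [gammaRoot_apply, reach_flip]
  have h2 : gammaRoot Q i = fun j => reach Q j i := funext fun j => gammaRoot_apply Q i j
  rw [eulerCoord_add, hτ.eulerCoord_flip_apply hQ hξ, h1, h2, eulerCoord_reach hG hQ hξ,
    eulerCoord_flip_reach hG hQ hξ, neg_add_cancel]

/-- The products `(τ y, α_i)` are the `eulerCoord Q` of `τ y - y`, and pairing with `γ_j`, whose
coordinates count paths to `j`, inverts `eulerCoord Q`. -/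
lemma IsAdaptedCoxeter.form_apply_gammaRoot (hG : G.IsAcyclic) (hQ : IsOrientation G Q)
    (hξ : IsHeight Q ξ) (hτ : IsAdaptedCoxeter G Q τ) (y : RootLattice I) (j : I) :
    form G (τ y) (gammaRoot Q j) = τ y j - y j := by
  have h : ∀ i, form G (τ y) (simpleRoot i) = eulerCoord Q (τ y - y) i := fun i => by
    rw [form_simpleRoot_eq_eulerCoord hQ hξ, hτ.eulerCoord_flip_apply hQ hξ, eulerCoord_sub,
      sub_eq_add_neg]
  rw [form_eq_sum_form_simpleRoot_mul]
  simp only [h, gammaRoot_apply]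
  exact sum_eulerCoord_mul_reach hG hQ hξ _ j

open Classical in
lemma gammaRoot_eq (hG : G.IsAcyclic) (hQ : IsOrientation G Q) (hξ : IsHeight Q ξ) (i : I) :
    gammaRoot Q i = simpleRoot i + ∑ k, if Q k i then gammaRoot Q k else 0 := by
  funext j
  have h := eulerCoord_reach hG hQ hξ j i
  have h' : (∑ k, if Q k i then gammaRoot Q k else 0) j = ∑ k, if Q k i then reach Q j k else 0 := by
    rw [Finset.sum_apply]
    refine Finset.sum_congr rfl fun k _ => ?_
    split_ifs
    · exact gammaRoot_apply Q k j
    · rfl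
  rw [Pi.add_apply, h', gammaRoot_apply, simpleRoot, Pi.single_apply]
  unfold eulerCoord at h
  omega

open Classical in
/-- The additivity of the Auslander–Reiten meshes. -/
lemma IsAdaptedCoxeter.gammaRoot_add_apply (hG : G.IsAcyclic) (hQ : IsOrientation G Q)
    (hξ : IsHeight Q ξ) (hτ : IsAdaptedCoxeter G Q τ) (i : I) :
    gammaRoot Q i + τ (gammaRoot Q i)
      = (∑ k, if Q i k then gammaRoot Q k else 0) + ∑ k, if Q k i then τ (gammaRoot Q k) else 0 := by
  -- The expansions for `Q` and for the reversed quiver share the term `τ(α_i)`, which cancels on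
  -- subtraction.
  have h1 := congrArg τ (gammaRoot_eq hG hQ hξ i)
  have h2 := congrArg τ (gammaRoot_eq hG hQ.flip hξ.flip i)
  rw [hτ.apply_gammaRoot_flip hG hQ hξ] at h2
  simp only [map_add, map_sum, apply_ite τ, map_zero, hτ.apply_gammaRoot_flip hG hQ hξ] at h1 h2
  have h3 : (∑ k, if flip Q k i then -gammaRoot Q k else 0)
      = -∑ k, if Q i k then gammaRoot Q k else 0 := by
    rw [← Finset.sum_neg_distrib]
    refine Finset.sum_congr rfl fun k _ => ?_
    by_cases h : Q i k <;> simp [h, flip]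
  rw [h3] at h2
  linear_combination (exp := 1) h1 - h2

end Coxeter


section Mesh

variable {I : Type*} [Fintype I] [DecidableEq I] {G : SimpleGraph I} {Q : I → I → Prop}
  {ξ : I → ℤ} {τ : RootLattice I ≃ₗ[ℤ] RootLattice I}

/-! ### The additive function on the repetition quiver -/

/-- The root `τ^{(ξ_i - p)/2}(γ_i)` at the vertex `(i, p)` of the repetition quiver, extended by
`0` to the pairs `(i, p)` of the wrong parity. -/
noncomputable def meshRoot (Q : I → I → Prop) (τ : RootLattice I ≃ₗ[ℤ] RootLattice I)
    (ξ : I → ℤ) (i : I) (p : ℤ) : RootLattice I :=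
  if Even (p - ξ i) then (τ ^ ((ξ i - p) / 2)) (gammaRoot Q i) else 0

lemma meshRoot_of_odd {i : I} {p : ℤ} (h : ¬ Even (p - ξ i)) : meshRoot Q τ ξ i p = 0 :=
  if_neg h

lemma meshRoot_of_eq {i : I} {p k : ℤ} (h : p = ξ i - 2 * k) :
    meshRoot Q τ ξ i p = (τ ^ k) (gammaRoot Q i) := by
  have h1 : Even (p - ξ i) := ⟨-k, by omega⟩
  have h2 : (ξ i - p) / 2 = k := by omega
  rw [meshRoot, if_pos h1, h2]

open Classical in
lemma IsAdaptedCoxeter.meshRoot_add (hG : G.IsAcyclic) (hQ : IsOrientation G Q)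
    (hξ : IsHeight Q ξ) (hτ : IsAdaptedCoxeter G Q τ) (i : I) (p : ℤ) :
    meshRoot Q τ ξ i p + meshRoot Q τ ξ i (p - 2)
      = ∑ k, if G.Adj i k then meshRoot Q τ ξ k (p - 1) else 0 := by
  by_cases hp : Even (p - ξ i)
  · obtain ⟨m, hm⟩ := hp
    -- A neighbour's height is one lower or one higher according to the direction of the arrow, so
    -- level `p - 1` there carries the exponent `-m` or `-m + 1`.
    have h := congrArg (τ ^ (-m)) (hτ.gammaRoot_add_apply hG hQ hξ i)
    have hstep : ∀ x, (τ ^ (-m)) (τ x) = (τ ^ (-m + 1)) x := fun x => by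
      rw [zpow_add_one]
      rfl
    rw [map_add, hstep] at h
    rw [meshRoot_of_eq (k := -m) (by omega), meshRoot_of_eq (k := -m + 1) (by omega), h,
      map_add, map_sum, map_sum, ← Finset.sum_add_distrib]
    refine Finset.sum_congr rfl fun k _ => ?_
    by_cases h1 : Q i k
    · have h2 := hQ.asymm _ _ h1
      have h3 := hξ _ _ h1
      rw [if_pos h1, if_neg h2, if_pos ((hQ.adj_iff i k).2 (Or.inl h1)),
        meshRoot_of_eq (k := -m) (by omega), map_zero, add_zero]
    · by_cases h2 : Q k i
      · have h3 := hξ _ _ h2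
        rw [if_neg h1, if_pos h2, if_pos ((hQ.adj_iff i k).2 (Or.inr h2)),
          meshRoot_of_eq (k := -m + 1) (by omega), map_zero, zero_add, hstep]
      · rw [if_neg h1, if_neg h2, if_neg (fun h => (hQ.adj_iff i k).1 h |>.elim h1 h2), map_zero,
          add_zero]
  · rw [meshRoot_of_odd hp, meshRoot_of_odd (by grind), add_zero, Finset.sum_eq_zero]
    intro k _
    split_ifs with hk
    · refine meshRoot_of_odd ?_
      rcases (hQ.adj_iff i k).1 hk with h | h <;> have := hξ _ _ h <;> grind
    · rfl

lemma meshRoot_height (i : I) : meshRoot Q τ ξ i (ξ i) = gammaRoot Q i :=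
  meshRoot_of_eq (k := 0) (by omega)

lemma IsAdaptedCoxeter.meshRoot_height_add_two (hG : G.IsAcyclic) (hQ : IsOrientation G Q)
    (hξ : IsHeight Q ξ) (hτ : IsAdaptedCoxeter G Q τ) (i : I) :
    meshRoot Q τ ξ i (ξ i + 2) = -gammaRoot (flip Q) i := by
  rw [meshRoot_of_eq (k := -1) (by omega), zpow_neg_one]
  refine τ.injective ?_
  rw [map_neg, hτ.apply_gammaRoot_flip hG hQ hξ, neg_neg]
  exact τ.apply_symm_apply _

/-- Upward induction on `p`. At `p = ξ i + 2` the vector counts paths starting at `i`, and none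
reaches `j` because `j` is higher; above that level the mesh relation stays inside the region. -/
lemma meshRoot_succ_apply_eq_zero (hG : G.IsAcyclic) (hQ : IsOrientation G Q)
    (hξ : IsHeight Q ξ) (hτ : IsAdaptedCoxeter G Q τ) (j : I) {i : I} {p : ℤ}
    (h1 : ξ i < p) (h2 : p ≤ ξ j + 1) : meshRoot Q τ ξ i p j = 0 := by
  classical
  obtain ⟨M, hM⟩ : ∃ M, ∀ k, M ≤ ξ k :=
    ((Set.finite_range ξ).bddBelow).imp fun M h k => h (Set.mem_range_self k)
  suffices H : ∀ n : ℕ, ∀ i p, ξ i < p → p ≤ ξ j + 1 → p ≤ M + n → meshRoot Q τ ξ i p j = 0 from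
    H (p - M).toNat i p h1 h2 (by omega)
  intro n
  induction n with
  | zero =>
    intro i p h1 _ h3
    have := hM i
    omega
  | succ n ih =>
    intro i p h1 h2 h3
    push_cast at h3
    rcases lt_trichotomy p (ξ i + 2) with h | h | h
    · rw [meshRoot_of_odd (by grind)]
      rfl
    · have hne : i ≠ j := by
        rintro rfl
        omega
      rw [h, hτ.meshRoot_height_add_two hG hQ hξ, Pi.neg_apply, gammaRoot_apply, reach_flip,
        reach_eq_zero hξ hne (by omega), neg_zero]
    · have hm := congrFun (hτ.meshRoot_add hG hQ hξ i p) j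
      rw [Pi.add_apply, ih i (p - 2) (by omega) (by omega) (by omega), add_zero,
        Finset.sum_apply] at hm
      rw [hm]
      refine Finset.sum_eq_zero fun k _ => ?_
      split_ifs with hk
      · refine ih k (p - 1) ?_ (by omega) (by omega)
        rcases (hQ.adj_iff i k).1 hk with h' | h' <;> have := hξ _ _ h' <;> omega
      · rfl

/-- The mirror argument, by downward induction from `p = ξ i`, where the vector is `γ_i`. The
excluded vertex `(j, ξ j)` carries the coordinate 1. -/
lemma meshRoot_le_apply_eq_zero (hG : G.IsAcyclic) (hQ : IsOrientation G Q)
    (hξ : IsHeight Q ξ) (hτ : IsAdaptedCoxeter G Q τ) (j : I) {i : I} {p : ℤ}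
    (h1 : ξ j ≤ p) (h2 : p ≤ ξ i) (hne : i = j → p ≠ ξ j) : meshRoot Q τ ξ i p j = 0 := by
  classical
  obtain ⟨M, hM⟩ : ∃ M, ∀ k, ξ k ≤ M :=
    ((Set.finite_range ξ).bddAbove).imp fun M h k => h (Set.mem_range_self k)
  suffices H : ∀ n : ℕ, ∀ i p, ξ j ≤ p → p ≤ ξ i → (i = j → p ≠ ξ j) → M - n < p →
      meshRoot Q τ ξ i p j = 0 from
    H (M - p + 1).toNat i p h1 h2 hne (by omega)
  intro n
  induction n with
  | zero =>
    intro i p _ h2 _ h3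
    have := hM i
    omega
  | succ n ih =>
    intro i p h1 h2 hne h3
    push_cast at h3
    rcases lt_trichotomy p (ξ i - 1) with h | h | h
    · have hm := congrFun (hτ.meshRoot_add hG hQ hξ i (p + 2)) j
      rw [Pi.add_apply, ih i (p + 2) (by omega) (by omega) (by omega) (by omega), zero_add,
        Finset.sum_apply, add_sub_cancel_right] at hm
      rw [hm]
      refine Finset.sum_eq_zero fun k _ => ?_
      split_ifs with hk
      · refine ih k (p + 2 - 1) (by omega) ?_ (by omega) (by omega)
        rcases (hQ.adj_iff i k).1 hk with h' | h' <;> have := hξ _ _ h' <;> omega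
      · rfl
    · rw [meshRoot_of_odd (by grind)]
      rfl
    · obtain rfl : p = ξ i := by omega
      have hji : j ≠ i := by
        rintro rfl
        exact hne rfl rfl
      rw [meshRoot_height, gammaRoot_apply, reach_eq_zero hξ hji h1]

lemma meshRoot_height_apply (hG : G.IsAcyclic) (hQ : IsOrientation G Q)
    (hξ : IsHeight Q ξ) (hτ : IsAdaptedCoxeter G Q τ) (i j : I) :
    meshRoot Q τ ξ i (ξ j) j = if i = j then 1 else 0 := by
  split_ifs with hij
  · rw [hij, meshRoot_height, gammaRoot_apply, reach_self]
  · rcases lt_or_ge (ξ i) (ξ j) with h | h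
    · exact meshRoot_succ_apply_eq_zero hG hQ hξ hτ j h (by omega)
    · exact meshRoot_le_apply_eq_zero hG hQ hξ hτ j le_rfl h fun h' => absurd h' hij

lemma meshRoot_height_add_one_apply (hG : G.IsAcyclic) (hQ : IsOrientation G Q)
    (hξ : IsHeight Q ξ) (hτ : IsAdaptedCoxeter G Q τ) (i j : I) :
    meshRoot Q τ ξ i (ξ j + 1) j = 0 := by
  rcases lt_or_ge (ξ i) (ξ j + 1) with h | h
  · exact meshRoot_succ_apply_eq_zero hG hQ hξ hτ j h le_rfl
  · exact meshRoot_le_apply_eq_zero hG hQ hξ hτ j (by omega) h fun _ => by omega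

/-! ### The inverse quantum Cartan matrix -/

open scoped RatFunc

/-- The power series whose coefficient at `z^m` is the coordinate at `α_j` of the root at
`(i, ξ_j + 1 - m)`. -/
noncomputable def meshSeries (Q : I → I → Prop) (τ : RootLattice I ≃ₗ[ℤ] RootLattice I)
    (ξ : I → ℤ) (i j : I) : PowerSeries ℚ :=
  PowerSeries.mk fun m => (meshRoot Q τ ξ i (ξ j + 1 - m) j : ℚ)

-- This is `C(z) S = 1` multiplied by `z`: degrees 0 and 1 are the initial values at heights `ξ j +
-- 1` and `ξ j`, and higher degrees are the mesh relation.
open Classical in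
lemma meshSeries_eq (hG : G.IsAcyclic) (hQ : IsOrientation G Q)
    (hξ : IsHeight Q ξ) (hτ : IsAdaptedCoxeter G Q τ) (i j : I) :
    meshSeries Q τ ξ i j + PowerSeries.X * (PowerSeries.X * meshSeries Q τ ξ i j)
      = PowerSeries.X * ((if i = j then 1 else 0)
        + ∑ k, if G.Adj i k then meshSeries Q τ ξ k j else 0) := by
  ext m
  rw [map_add]
  rcases m with _ | m
  · simp [meshSeries, meshRoot_height_add_one_apply hG hQ hξ hτ]
  · rw [PowerSeries.coeff_succ_X_mul, PowerSeries.coeff_succ_X_mul, map_add, map_sum]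
    rcases m with _ | m
    · have h : ∀ k, PowerSeries.coeff 0 (if G.Adj i k then meshSeries Q τ ξ k j else 0) = 0 := by
        intro k
        split_ifs
        · simp [meshSeries, meshRoot_height_add_one_apply hG hQ hξ hτ]
        · simp
      rw [Finset.sum_eq_zero fun k _ => h k, PowerSeries.coeff_zero_X_mul]
      simp only [meshSeries, PowerSeries.coeff_mk]
      have := meshRoot_height_apply hG hQ hξ hτ i j
      norm_num
      rw [this]
      split_ifs <;> simp
    · rw [PowerSeries.coeff_succ_X_mul]
      have h0 : PowerSeries.coeff (m + 1) (if i = j then (1 : PowerSeries ℚ) else 0) = 0 := by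
        split_ifs <;> simp [PowerSeries.coeff_one]
      have h : ∀ k, PowerSeries.coeff (m + 1) (if G.Adj i k then meshSeries Q τ ξ k j else 0)
          = ((if G.Adj i k then meshRoot Q τ ξ k (ξ j - m - 1 + 1) j else 0 : ℤ) : ℚ) := by
        intro k
        split_ifs
        · simp only [meshSeries, PowerSeries.coeff_mk]
          congr 3
          push_cast
          ring
        · simp
      rw [h0, zero_add, Finset.sum_congr rfl fun k _ => h k]
      have hm := congrFun (hτ.meshRoot_add hG hQ hξ i (ξ j - m - 1 + 2)) j
      rw [Pi.add_apply, Finset.sum_apply] at hm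
      have e1 : ξ j + 1 - ((m + 1 + 1 : ℕ) : ℤ) = ξ j - m - 1 + 2 - 2 := by
        push_cast
        ring
      have e2 : ξ j + 1 - (m : ℤ) = ξ j - m - 1 + 2 := by ring
      have e3 : ξ j - (m : ℤ) - 1 + 2 - 1 = ξ j - m - 1 + 1 := by ring
      simp only [e3, ite_apply, Pi.zero_apply] at hm
      simp only [meshSeries, PowerSeries.coeff_mk]
      rw [← Int.cast_sum, ← Int.cast_add, ← hm, e1, e2, add_comm]

open Classical in
/-- The expansion at `z = 0` of the inverse of the matrix with `z + z⁻¹` on the diagonal and `-1`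
at adjacent vertices is determined by the recursion for its entries. -/
lemma inv_apply_coe_eq_ofPowerSeries {F : Type*} [Field F] (G : SimpleGraph I)
    (M : Matrix I I (RatFunc F)) (S : I → I → PowerSeries F)
    (hM : ∀ i j, M i j
      = if i = j then RatFunc.X + RatFunc.X⁻¹ else if G.Adj i j then -1 else 0)
    (hS : ∀ i j, S i j + PowerSeries.X * (PowerSeries.X * S i j)
      = PowerSeries.X * ((if i = j then 1 else 0) + ∑ k, if G.Adj i k then S k j else 0))
    (i j : I) :
    ((M⁻¹ i j : RatFunc F) : LaurentSeries F) = HahnSeries.ofPowerSeries ℤ F (S i j) := by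
  set φ := algebraMap (RatFunc F) (LaurentSeries F) with hφ
  set ψ := HahnSeries.ofPowerSeries ℤ F with hψ
  set N : Matrix I I (LaurentSeries F) := Matrix.of fun i j => ψ (S i j) with hN
  have hX : φ RatFunc.X = ψ PowerSeries.X := by
    rw [hφ, RatFunc.coe_X, hψ, HahnSeries.ofPowerSeries_X]
  have hX0 : φ RatFunc.X ≠ 0 := by
    rw [map_ne_zero]
    exact RatFunc.X_ne_zero
  have hmul : φ.mapMatrix M * N = 1 := by
    ext1 i j
    have h := congrArg ψ (hS i j)
    simp only [map_add, map_mul, map_sum, apply_ite ψ, map_zero, map_one, ← hX] at h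
    rw [Matrix.mul_apply, Matrix.one_apply]
    have hterm : ∀ k, φ.mapMatrix M i k * N k j
        = (if i = k then (φ RatFunc.X + (φ RatFunc.X)⁻¹) * ψ (S k j) else 0)
          - if G.Adj i k then ψ (S k j) else 0 := by
      intro k
      rw [RingHom.mapMatrix_apply, Matrix.map_apply, hN, hM, Matrix.of_apply]
      by_cases hik : i = k
      · subst hik
        simp
      · by_cases ha : G.Adj i k <;> simp [hik, ha]
    rw [Finset.sum_congr rfl fun k _ => hterm k, Finset.sum_sub_distrib, Finset.sum_ite_eq,
      if_pos (Finset.mem_univ _), sub_eq_iff_eq_add]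
    refine mul_left_cancel₀ hX0 ?_
    rw [← h]
    field_simp
    ring
  -- The right inverse over Laurent series forces the determinant to be nonzero already over
  -- `RatFunc F`.
  have hdet : IsUnit M.det := by
    rw [isUnit_iff_ne_zero]
    intro h0
    have h := congrArg Matrix.det hmul
    rw [Matrix.det_mul, ← RingHom.map_det, h0, map_zero, zero_mul, Matrix.det_one] at h
    exact zero_ne_one h
  have hinv : φ.mapMatrix M⁻¹ = N := by
    refine left_inv_eq_right_inv ?_ hmul
    rw [← map_mul, Matrix.nonsing_inv_mul _ hdet, map_one]
  exact congrFun (congrFun hinv i) j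

lemma quantumCartan_inv_coe (hG : G.IsAcyclic) (hQ : IsOrientation G Q)
    (hξ : IsHeight Q ξ) (hτ : IsAdaptedCoxeter G Q τ) (i j : I) :
    (((quantumCartan G)⁻¹ i j : RatFunc ℚ) : LaurentSeries ℚ)
      = HahnSeries.ofPowerSeries ℤ ℚ (meshSeries Q τ ξ i j) :=
  inv_apply_coe_eq_ofPowerSeries G (quantumCartan G) (meshSeries Q τ ξ) (fun _ _ => rfl)
    (meshSeries_eq hG hQ hξ hτ) i j

lemma cTilde_of_nonpos (G : SimpleGraph I) (i j : I) {m : ℤ} (hm : m ≤ 0) :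
    cTilde G i j m = 0 := if_neg (by omega)

lemma cTilde_eq_meshRoot (hG : G.IsAcyclic) (hQ : IsOrientation G Q)
    (hξ : IsHeight Q ξ) (hτ : IsAdaptedCoxeter G Q τ) (i j : I) {m : ℤ} (hm : 0 ≤ m) :
    cTilde G i j m = (meshRoot Q τ ξ i (ξ j + 1 - m) j : ℤ) := by
  -- At `m = 0` the convention `C̃(0) = 0` agrees with the vanishing coordinate; this case occurs
  -- when `s = p + 1`.
  rcases hm.eq_or_lt with rfl | hm'
  · rw [cTilde_of_nonpos G i j le_rfl, sub_zero, meshRoot_height_add_one_apply hG hQ hξ hτ,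
      Int.cast_zero]
  · lift m to ℕ using hm
    rw [cTilde, if_pos (by omega), quantumCartan_inv_coe hG hQ hξ hτ,
      HahnSeries.ofPowerSeries_apply_coeff, meshSeries, PowerSeries.coeff_mk]

lemma commExponent_eq_form (hG : G.IsAcyclic) (hQ : IsOrientation G Q)
    (hξ : IsHeight Q ξ) (hτ : IsAdaptedCoxeter G Q τ) {i j : I} {p s : ℤ}
    (hip : (i, p) ∈ repetitionVertices ξ) (hjs : (j, s) ∈ repetitionVertices ξ) (hps : p < s) :
    commExponent G i p j s
      = (form G ((τ ^ ((s - p + ξ i - ξ j) / 2)) (gammaRoot Q i)) (gammaRoot Q j) : ℤ) := by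
  obtain ⟨a, ha⟩ := hip
  obtain ⟨b, hb⟩ := hjs
  simp only at ha hb
  have hk : (s - p + ξ i - ξ j) / 2 = 1 + (b - a - 1) := by omega
  have hτk : (τ ^ (1 + (b - a - 1))) (gammaRoot Q i)
      = τ ((τ ^ (b - a - 1)) (gammaRoot Q i)) := by
    rw [zpow_one_add]
    rfl
  rw [commExponent, cTilde_of_nonpos G i j (by omega : p - s - 1 ≤ 0),
    cTilde_of_nonpos G i j (by omega : p - s + 1 ≤ 0),
    cTilde_eq_meshRoot hG hQ hξ hτ i j (by omega : 0 ≤ s - p - 1),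
    cTilde_eq_meshRoot hG hQ hξ hτ i j (by omega : 0 ≤ s - p + 1), hk,
    meshRoot_of_eq (k := b - a - 1) (by omega), meshRoot_of_eq (k := 1 + (b - a - 1)) (by omega),
    hτk, hτ.form_apply_gammaRoot hG hQ hξ]
  push_cast
  ring

/-! ### The labelling -/

/-- Either branch applies `τ` and changes the sign exactly when the integer label changes by one, so
the identity holds whichever branch is taken. -/
lemma labelDown_iterate (G : SimpleGraph I) (τ : RootLattice I ≃ₗ[ℤ] RootLattice I)
    (x : RootLattice I) (n : ℕ) :
    ((labelDown G τ)^[n] (x, 0)).1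
      = (((labelDown G τ)^[n] (x, 0)).2.negOnePow : ℤ) • (τ ^ (n : ℤ)) x := by
  induction n with
  | zero => simp
  | succ n ih =>
    rw [Function.iterate_succ_apply']
    have h : (τ ^ ((n + 1 : ℕ) : ℤ)) x = τ ((τ ^ (n : ℤ)) x) := by
      rw [Nat.cast_succ, add_comm, zpow_one_add]
      rfl
    set y := (labelDown G τ)^[n] (x, 0)
    rw [h, labelDown]
    split_ifs
    · simp only
      rw [ih, map_zsmul]
    · simp only
      rw [ih, map_zsmul, Int.negOnePow_sub, Int.negOnePow_one]
      simp

lemma labelUp_iterate (G : SimpleGraph I) (τ : RootLattice I ≃ₗ[ℤ] RootLattice I)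
    (x : RootLattice I) (n : ℕ) :
    ((labelUp G τ)^[n] (x, 0)).1
      = (((labelUp G τ)^[n] (x, 0)).2.negOnePow : ℤ) • (τ ^ (-(n : ℤ))) x := by
  induction n with
  | zero => simp
  | succ n ih =>
    rw [Function.iterate_succ_apply']
    have h : (τ ^ (-((n + 1 : ℕ) : ℤ))) x = τ⁻¹ ((τ ^ (-(n : ℤ))) x) := by
      rw [Nat.cast_succ, neg_add_rev, zpow_add, zpow_neg_one]
      rfl
    set y := (labelUp G τ)^[n] (x, 0)
    rw [h, labelUp]
    split_ifs
    · simp only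
      rw [ih, map_zsmul]
    · simp only
      rw [ih, map_zsmul, Int.negOnePow_succ]
      simp

/-- The labelling gives the roots `τ^{(ξ_i - p)/2}(γ_i)` up to the sign `(-1)^m`. -/
lemma labelling_fst {i : I} {p : ℤ} (hip : (i, p) ∈ repetitionVertices ξ) :
    (labelling G Q τ ξ ⟨(i, p), hip⟩).1
      = ((labelling G Q τ ξ ⟨(i, p), hip⟩).2.negOnePow : ℤ)
        • (τ ^ (-((p - ξ i) / 2))) (gammaRoot Q i) := by
  unfold labelling
  simp only
  split_ifs with h
  · rw [labelUp_iterate, Int.toNat_of_nonneg h]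
  · rw [labelDown_iterate, Int.toNat_of_nonneg (by omega)]

end Mesh

end QuantumTorusADE

theorem mainTheorem9 {I : Type*} [Fintype I] [DecidableEq I]
    (G : SimpleGraph I) (hG : QuantumTorusADE.IsADE G)
    (Q : I → I → Prop) (hQ : QuantumTorusADE.IsOrientation G Q)
    (ξ : I → ℤ) (hξ : QuantumTorusADE.IsHeight Q ξ)
    (τ : QuantumTorusADE.RootLattice I ≃ₗ[ℤ] QuantumTorusADE.RootLattice I)
    (hτ : QuantumTorusADE.IsAdaptedCoxeter G Q τ)
    (i j : I) (p s : ℤ)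
    (hip : (i, p) ∈ QuantumTorusADE.repetitionVertices ξ)
    (hjs : (j, s) ∈ QuantumTorusADE.repetitionVertices ξ)
    (hps : p < s) :
    QuantumTorusADE.commExponent G i p j s =
        (QuantumTorusADE.form G
          ((τ ^ ((s - p + ξ i - ξ j) / 2)) (QuantumTorusADE.gammaRoot Q i))
          (QuantumTorusADE.gammaRoot Q j) : ℤ) ∧
    ∀ (β δ : QuantumTorusADE.RootLattice I) (m l : ℤ),
      QuantumTorusADE.labelling G Q τ ξ ⟨(i, p), hip⟩ = (β, m) →
      QuantumTorusADE.labelling G Q τ ξ ⟨(j, s), hjs⟩ = (δ, l) →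
      QuantumTorusADE.commExponent G i p j s =
        (-1 : ℚ) ^ (l - m) * (QuantumTorusADE.form G β δ : ℤ) := by
  have key := QuantumTorusADE.commExponent_eq_form hG.isAcyclic hQ hξ hτ hip hjs hps
  refine ⟨key, fun β δ m l hβ hδ => ?_⟩
  have h1 := QuantumTorusADE.labelling_fst (G := G) (Q := Q) (τ := τ) hip
  have h2 := QuantumTorusADE.labelling_fst (G := G) (Q := Q) (τ := τ) hjs
  rw [hβ] at h1
  rw [hδ] at h2
  simp only at h1 h2
  obtain ⟨a, ha⟩ := hip
  obtain ⟨b, hb⟩ := hjs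
  simp only at ha hb
  have hk : (s - p + ξ i - ξ j) / 2 = b + -a := by omega
  have hp : (p - ξ i) / 2 = a := by omega
  have hs : (s - ξ j) / 2 = b := by omega
  rw [hp] at h1
  rw [hs] at h2
  have hinv : (τ ^ b) ((τ ^ (-b)) (QuantumTorusADE.gammaRoot Q j))
      = QuantumTorusADE.gammaRoot Q j := by
    change (τ ^ b * τ ^ (-b)) _ = _
    rw [← zpow_add, add_neg_cancel, zpow_zero]
    rfl
  have hpow : (τ ^ (b + -a)) (QuantumTorusADE.gammaRoot Q i)
      = (τ ^ b) ((τ ^ (-a)) (QuantumTorusADE.gammaRoot Q i)) := by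
    rw [zpow_add]
    rfl
  -- Removing `τ ^ b` from both arguments turns the first formula into the product of the unsigned
  -- vectors at `(i, p)` and `(j, s)`.
  have hform := hτ.form_zpow_apply b ((τ ^ (-a)) (QuantumTorusADE.gammaRoot Q i))
    ((τ ^ (-b)) (QuantumTorusADE.gammaRoot Q j))
  rw [hinv] at hform
  rw [key, hk, hpow, hform, h1, h2, QuantumTorusADE.form_zsmul_zsmul]
  have hsign : (-1 : ℚ) ^ (l - m) = ((l - m).negOnePow : ℤ) := by
    rw [Int.cast_negOnePow]
  have hone : ((l - m).negOnePow : ℤ) * (m.negOnePow * l.negOnePow) = 1 := by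
    rw [← Units.val_mul, ← Units.val_mul, Int.negOnePow_sub, mul_mul_mul_comm, mul_comm l.negOnePow,
      mul_comm m.negOnePow, mul_mul_mul_comm]
    simp [Int.units_mul_self]
  rw [hsign, ← Int.cast_mul, ← mul_assoc, hone, one_mul]
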